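/- **Setting.** Let $S$ be a compact $C^2$ manifold of dimension $D$ with (possibly empty) boundary. A critical point $p$ of a $C^2$ function $f:S\to\mathbb R$ is a *Morse point* of $f$ if the Hessian matrix $H_f(p)$, computed in local coordinates, is invertible (this does not depend on the coordinates), and $f$ is *Morse* if it is $C^2$ and all its critical points are Morse points. We write $f_n\xrightarrow{C^2}f$ if $f_n$ and $f$ are $C^2$ and, in local coordinates, all partial derivatives of $f_n$ of orders $0,1,2$ converge to those of $f$ uniformly (on compact subsets of each chart domain). **Theorem.** Let $f_n:S\to\mathbb R$ be $C^2$, let $f:S\to\mathbb R$ be Morse, let $p_n$ be a Morse point of $f_n$ for every $n$, and let $p\in\operatorname{Int}(S)$ be a Morse point of $f$ with $p_n\to p$. Suppose that $f_n\xrightarrow{C^2}f$. Take any $C^2$ chart of $S$ whose domain $U$ contains $p$ and use it to identify $U$ with a subset of $\mathbb R^D$ (in the boundary case, of a half-space); Hessians, differences $x-p$ and closed balls $B_\rho(\cdot)\subset\mathbb R^D$ are taken in these coordinates. Then $p_n\in U\cap\operatorname{Int}(S)$ for all but finitely many $n$, and there are a sequence $r_n>0$ converging to a limit $r>0$, a constant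 $\tilde r>0$, and maps $\Gamma$ and $\Gamma_n$ such that: 1. $B_r(p)\subseteq U$, and $\Gamma:B_r(p)\to U\subset\mathbb R^D$ is a bi-Lipschitz $C^1$ diffeomorphism onto its image with $\Gamma(p)=p$ and $$f(\Gamma(x)) = f(p)+\tfrac12 (x-p)'H_f(p)(x-p)\qquad\text{for all }x\in B_r(p);$$ 2. for every $n$ with $p_n\in U\cap\operatorname{Int}(S)$: $B_{r_n}(p_n)\subseteq U$, and $\Gamma_n:B_{r_n}(p_n)\to U\subset\mathbb R^D$ is a bi-Lipschitz $C^1$ diffeomorphism onto its image with $\Gamma_n(p_n)=p_n$ and $$f_n(\Gamma_n(x)) = f_n(p_n)+\tfrac12 (x-p_n)'H_{f_n}(p_n)(x-p_n)\qquad\text{for all }x\in B_{r_n}(p_n);$$ 3. $B_{\tilde r}(p)\subseteq B_r(p)$, and $B_{\tilde r}(p)\subseteq B_{r_n}(p_n)$ for all but finitely many $n$ (so that $\Gamma_n-\Gamma$ is defined on $B_{\tilde r}(p)$), and $\Gamma_n\to\Gamma$ uniformly on $B_{\tilde r}(p)$. -/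

import Mathlib

open Set Filter Topology
open scoped Manifold ContDiff Matrix

noncomputable section

/-- The Hessian matrix of `f : S → ℝ` at `p`, in the coordinates of the chart `φ`: the matrix of
second partial derivatives of `f ∘ φ⁻¹` at the coordinates of `p`. At boundary points the
derivatives are one-sided, i.e. taken within the closed model domain `range I`; at interior points
they are the ordinary ones. -/
def hessianInChart {D : ℕ} {H : Type*} [TopologicalSpace H]
    (I : ModelWithCorners ℝ (EuclideanSpace ℝ (Fin D)) H)
    {S : Type*} [TopologicalSpace S]
    (φ : OpenPartialHomeomorph S H) (f : S → ℝ) (p : S) : Matrix (Fin D) (Fin D) ℝ :=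
  Matrix.of fun i j =>
    iteratedFDerivWithin ℝ 2 (f ∘ (φ.extend I).symm) (range I) (φ.extend I p)
      ![EuclideanSpace.single i 1, EuclideanSpace.single j 1]

/-- `p` is a Morse point (non-degenerate critical point) of `f`. For a `C²` function,
non-vanishing of the Hessian determinant at a critical point does not depend on the chart. -/
def IsMorsePoint {D : ℕ} {H : Type*} [TopologicalSpace H]
    (I : ModelWithCorners ℝ (EuclideanSpace ℝ (Fin D)) H)
    {S : Type*} [TopologicalSpace S] [ChartedSpace H S] (f : S → ℝ) (p : S) : Prop :=
  mfderiv I 𝓘(ℝ, ℝ) f p = 0 ∧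
    ∀ φ ∈ IsManifold.maximalAtlas I 2 S, p ∈ φ.source → (hessianInChart I φ f p).det ≠ 0

/-- `f` is a Morse function: it is `C²` and all of its critical points are non-degenerate. -/
def IsMorse {D : ℕ} {H : Type*} [TopologicalSpace H]
    (I : ModelWithCorners ℝ (EuclideanSpace ℝ (Fin D)) H)
    {S : Type*} [TopologicalSpace S] [ChartedSpace H S] (f : S → ℝ) : Prop :=
  ContMDiff I 𝓘(ℝ, ℝ) 2 f ∧
    ∀ p : S, mfderiv I 𝓘(ℝ, ℝ) f p = 0 → IsMorsePoint I f p

/-- Convergence in the `C²` metric: all functions are `C²` and all partial derivatives of order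
`0, 1, 2` converge uniformly. On a manifold this means: uniformly on compact subsets of the domain
of each chart, in the coordinates of that chart (for compact `S`, finitely many such compact sets
cover `S`). -/
def TendstoC2 {D : ℕ} {H : Type*} [TopologicalSpace H]
    (I : ModelWithCorners ℝ (EuclideanSpace ℝ (Fin D)) H)
    {S : Type*} [TopologicalSpace S] [ChartedSpace H S]
    (F : ℕ → S → ℝ) (f : S → ℝ) : Prop :=
  (∀ n, ContMDiff I 𝓘(ℝ, ℝ) 2 (F n)) ∧ ContMDiff I 𝓘(ℝ, ℝ) 2 f ∧
    ∀ φ ∈ IsManifold.maximalAtlas I 2 S, ∀ K : Set S, IsCompact K → K ⊆ φ.source →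
      ∀ j : ℕ, j ≤ 2 →
        TendstoUniformlyOn
          (fun n => iteratedFDerivWithin ℝ j (F n ∘ (φ.extend I).symm) (range I))
          (iteratedFDerivWithin ℝ j (f ∘ (φ.extend I).symm) (range I))
          atTop (φ.extend I '' K)

/-- `Γ` restricts to a bi-Lipschitz (`C¹`) diffeomorphism of `A` onto its image `Γ(A)`. -/
def IsBiLipschitzDiffeoOn {E : Type*} [NormedAddCommGroup E] [NormedSpace ℝ E]
    (Γ : E → E) (A : Set E) : Prop :=
  (∃ C, LipschitzOnWith C Γ A) ∧ (∃ c, AntilipschitzWith c (A.domRestrict Γ)) ∧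
    ContDiffOn ℝ 1 Γ A ∧ ∃ Δ : E → E, LeftInvOn Δ Γ A ∧ ContDiffOn ℝ 1 Δ (Γ '' A)

/-- In the coordinates of the chart `φ`, `Γ` is a Morse-lemma change of coordinates for `f` at `p`,
defined on the closed ball of radius `r` about (the coordinates of) `p`: a bi-Lipschitz
diffeomorphism onto its image, fixing `p`, with
`f (Γ x) = f p + (1/2) (x - p)' H_f(p) (x - p)` on the ball. Both the ball and its image lie in the
coordinate domain of `φ`, so that `f (Γ x)` is meaningful. -/
def IsMorseCoordinateChange {D : ℕ} {H : Type*} [TopologicalSpace H]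
    (I : ModelWithCorners ℝ (EuclideanSpace ℝ (Fin D)) H)
    {S : Type*} [TopologicalSpace S]
    (φ : OpenPartialHomeomorph S H) (f : S → ℝ) (p : S) (r : ℝ)
    (Γ : EuclideanSpace ℝ (Fin D) → EuclideanSpace ℝ (Fin D)) : Prop :=
  Metric.closedBall (φ.extend I p) r ⊆ (φ.extend I).target ∧
    IsBiLipschitzDiffeoOn Γ (Metric.closedBall (φ.extend I p) r) ∧
    MapsTo Γ (Metric.closedBall (φ.extend I p) r) (φ.extend I).target ∧
    Γ (φ.extend I p) = φ.extend I p ∧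
    ∀ x ∈ Metric.closedBall (φ.extend I p) r,
      f ((φ.extend I).symm (Γ x)) =
        f p + (1 / 2 : ℝ) * ((x - φ.extend I p).ofLp ⬝ᵥ
          (hessianInChart I φ f p *ᵥ (x - φ.extend I p).ofLp))

end

/-! Near a nondegenerate critical point `x₀`, with Hessian `B`, let `L` be `B⁻¹` composed with the
Riesz map, so that `B (L y) v = ⟪y, v⟫`. Put `y = z - x₀` and look for a change of variables of the
form `z + s(z) L y`. Half the quadratic form at `y + s L y` is `B(y,y)/2 + s‖y‖² + s²⟪y, L y⟫/2`, so
it equals `f z - f x₀` exactly when `s + c s² = w`, where `w` is the second order Taylor remainder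
divided by `‖y‖²` and `c = ⟪y, L y⟫ / (2‖y‖²)`. This scalar equation has an explicit small root.

If the Hessian varies by at most `ε`, then `|s| ≤ 2ε` and `‖Ds‖ ≤ 10ε/‖y‖`. The factor `L y` absorbs
the singularity, so the displacement is `C¹` even at `x₀`, with derivative at most `12ε‖L‖ ≤ 1/2`.
The map is thus a perturbation of the identity whose radius and Lipschitz constants depend on `R`
alone and on nothing else, respectively; its inverse is the Morse coordinate change.

`C²` convergence makes `R` and `ε` common to `f` and almost all `f_n`. The explicit formula gives
pointwise convergence of the straightening maps, the bound `dist_le_two_mul` carries it to the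
inverses, and the common Lipschitz constant makes it uniform. -/

/-! ### The scalar quadratic equation. -/

/-- The root of `s + c * s ^ 2 = w` that vanishes at `w = 0`. -/
noncomputable def quadRoot (w c : ℝ) : ℝ := 2 * w / (1 + √(1 + 4 * w * c))

theorem quadRoot_add {w c : ℝ} (h : 0 ≤ 1 + 4 * w * c) :
    quadRoot w c + c * quadRoot w c ^ 2 = w := by
  have h1 := Real.sq_sqrt h
  have h2 : 0 < 1 + √(1 + 4 * w * c) := by positivity
  unfold quadRoot
  generalize √(1 + 4 * w * c) = t at *
  field_simp
  linear_combination (-w) * h1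

/-- The rationalised form of the root has a denominator at least `1`, which covers `c = 0` and makes
the bound independent of the sign of the discriminant. -/
theorem abs_quadRoot_le (w c : ℝ) : |quadRoot w c| ≤ 2 * |w| := by
  have h2 : 1 ≤ 1 + √(1 + 4 * w * c) := by linarith [Real.sqrt_nonneg (1 + 4 * w * c)]
  unfold quadRoot
  rw [abs_div, abs_mul, abs_two, abs_of_pos (by linarith : 0 < 1 + √(1 + 4 * w * c))]
  exact div_le_self (by positivity) h2

theorem ContDiffAt.quadRoot {E : Type*} [NormedAddCommGroup E] [NormedSpace ℝ E] {n : ℕ∞ω}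
    {w c : E → ℝ} {z : E} (hw : ContDiffAt ℝ n w z) (hc : ContDiffAt ℝ n c z)
    (h : 0 < 1 + 4 * w z * c z) : ContDiffAt ℝ n (fun z => quadRoot (w z) (c z)) z := by
  have h1 : ContDiffAt ℝ n (fun z => 1 + 4 * w z * c z) z := by fun_prop
  have h2 := h1.sqrt h.ne'
  unfold _root_.quadRoot
  refine (contDiffAt_const.mul hw).div (contDiffAt_const.add h2) ?_
  positivity

/-- Implicit differentiation of `s + c s² = w` gives `(1 + 2sc) Ds = Dw - s² Dc`. The left factor is
at least `1/2` and the right side is at most `5ε/ρ`. -/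
theorem norm_fderiv_quadRoot_le {E : Type*} [NormedAddCommGroup E] [NormedSpace ℝ E]
    {w c : E → ℝ} {z : E} {ε M ρ : ℝ} (hw : ContDiffAt ℝ 1 w z) (hc : ContDiffAt ℝ 1 c z)
    (hρ : 0 < ρ) (hε : 0 ≤ ε) (hεM : ε * M ≤ 1 / 4)
    (hwε : |w z| ≤ ε) (hcM : |c z| ≤ M / 2)
    (hw' : ‖fderiv ℝ w z‖ ≤ 3 * ε / ρ) (hc' : ‖fderiv ℝ c z‖ ≤ 2 * M / ρ) :
    ‖fderiv ℝ (fun z => quadRoot (w z) (c z)) z‖ ≤ 10 * ε / ρ := by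
  have hwc : |w z * c z| ≤ ε * (M / 2) := by rw [abs_mul]; gcongr
  have hpos : 0 < 1 + 4 * w z * c z := by linarith [neg_le_of_abs_le hwc]
  have hs := hw.quadRoot hc hpos
  set s : E → ℝ := fun z => quadRoot (w z) (c z) with hsdef
  have hsd := (hs.differentiableAt one_ne_zero).hasFDerivAt
  have hwd := (hw.differentiableAt one_ne_zero).hasFDerivAt
  have hcd := (hc.differentiableAt one_ne_zero).hasFDerivAt
  have hsε : |s z| ≤ 2 * ε := (abs_quadRoot_le _ _).trans (by linarith)
  have hev : (fun z => s z + c z * s z ^ 2) =ᶠ[𝓝 z] w := by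
    have : ContinuousAt (fun z => 1 + 4 * w z * c z) z :=
      (continuousAt_const.add ((continuousAt_const.mul hw.continuousAt).mul hc.continuousAt))
    filter_upwards [this.eventually (lt_mem_nhds hpos)] with y hy
    exact quadRoot_add hy.le
  have hd := (hsd.add (hcd.mul (hsd.pow 2))).congr_of_eventuallyEq hev.symm
  have heq := hd.unique hwd
  set S := fderiv ℝ s z
  set W := fderiv ℝ w z
  set C := fderiv ℝ c z
  have heq2 : (1 + 2 * s z * c z) • S = W - (s z ^ 2) • C := by
    rw [← heq]
    ext v
    simp
    ring
  have hsc : |s z * c z| ≤ 2 * ε * (M / 2) := by rw [abs_mul]; gcongr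
  have h12 : 1 / 2 ≤ 1 + 2 * s z * c z := by linarith [neg_le_of_abs_le hsc]
  have hn : ‖(1 + 2 * s z * c z) • S‖ ≤ 5 * ε / ρ := by
    rw [heq2]
    calc ‖W - (s z ^ 2) • C‖ ≤ ‖W‖ + ‖(s z ^ 2) • C‖ := norm_sub_le _ _
      _ = ‖W‖ + |s z| ^ 2 * ‖C‖ := by rw [norm_smul, Real.norm_eq_abs, abs_pow]
      _ ≤ 3 * ε / ρ + (2 * ε) ^ 2 * (2 * M / ρ) := by gcongr
      _ = (3 * ε + 8 * ε * (ε * M)) / ρ := by ring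
      _ ≤ (3 * ε + 8 * ε * (1 / 4)) / ρ := by gcongr
      _ = 5 * ε / ρ := by ring
  rw [norm_smul, Real.norm_eq_abs, abs_of_pos (by linarith)] at hn
  have : 1 / 2 * ‖S‖ ≤ 5 * ε / ρ := le_trans (by gcongr) hn
  have e : 10 * ε / ρ = 2 * (5 * ε / ρ) := by ring
  linarith

/-! ### Quotients by the squared distance to a point. -/

section

variable {E : Type*} [NormedAddCommGroup E] [InnerProductSpace ℝ E]

theorem hasFDerivAt_norm_sub_sq (x₀ z : E) :
    HasFDerivAt (fun z => ‖z - x₀‖ ^ 2) (2 • (innerSL ℝ (z - x₀))) z := by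
  simpa using! ((hasFDerivAt_id z).sub_const x₀).norm_sq

theorem norm_fderiv_div_norm_sq_le {h : E → ℝ} {x₀ z : E} {a b : ℝ} (hz : z ≠ x₀)
    (hd : DifferentiableAt ℝ h z) (ha : |h z| ≤ a * ‖z - x₀‖ ^ 2)
    (hb : ‖fderiv ℝ h z‖ ≤ b * ‖z - x₀‖) :
    ‖fderiv ℝ (fun z => h z / ‖z - x₀‖ ^ 2) z‖ ≤ (b + 2 * a) / ‖z - x₀‖ := by
  have hρ : 0 < ‖z - x₀‖ := norm_pos_iff.2 (sub_ne_zero.2 hz)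
  set ρ := ‖z - x₀‖ with hρd
  have hN : HasFDerivAt (fun z => (‖z - x₀‖ ^ 2)⁻¹) _ z :=
    (hasDerivAt_inv (by rw [← hρd]; positivity)).comp_hasFDerivAt z (hasFDerivAt_norm_sub_sq x₀ z)
  simp only [div_eq_mul_inv (h _)]
  rw [(hd.hasFDerivAt.fun_mul hN).fderiv, ← hρd]
  have h2 : ‖2 • innerSL ℝ (z - x₀)‖ ≤ 2 * ρ := by
    refine norm_nsmul_le.trans ?_
    rw [innerSL_apply_norm]
    norm_num [hρd]
  refine (norm_add_le _ _).trans ?_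
  generalize 2 • innerSL ℝ (z - x₀) = N at h2 hN ⊢
  rw [norm_smul, norm_smul, norm_smul, Real.norm_eq_abs, Real.norm_eq_abs, Real.norm_eq_abs,
    abs_neg, abs_of_pos (by positivity : 0 < ((ρ ^ 2) ^ 2)⁻¹),
    abs_of_pos (by positivity : 0 < (ρ ^ 2)⁻¹)]
  have ha0 : 0 ≤ a * ρ ^ 2 := (abs_nonneg _).trans ha
  calc _ ≤ a * ρ ^ 2 * (((ρ ^ 2) ^ 2)⁻¹ * (2 * ρ)) + (ρ ^ 2)⁻¹ * (b * ρ) := by gcongr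
    _ = _ := by field_simp; ring

end

/-! ### The straightening map of one function. -/

section

variable {E : Type*} [NormedAddCommGroup E] [InnerProductSpace ℝ E]

open Metric
open scoped RealInnerProductSpace

/-- On `ball x₀ R`, the function `f` is `C²` with second derivative `ε`-close to its second
derivative `B` at the critical point `x₀`; `L` is the inverse of `B` composed with the Riesz map,
and `ε` is small in terms of `L`. -/
structure IsNearlyQuadraticOn (f : E → ℝ) (B : E →L[ℝ] E →L[ℝ] ℝ) (L : E →L[ℝ] E)
    (x₀ : E) (R ε : ℝ) : Prop where
  pos : 0 < R
  contDiffOn : ContDiffOn ℝ 2 f (ball x₀ R)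
  fderiv_center : fderiv ℝ f x₀ = 0
  hessian_center : fderiv ℝ (fderiv ℝ f) x₀ = B
  dual : ∀ y v, B (L y) v = ⟪y, v⟫
  hessian_close : ∀ x ∈ ball x₀ R, ‖fderiv ℝ (fderiv ℝ f) x - B‖ ≤ ε
  small : 24 * (ε * ‖L‖) ≤ 1

/-- The difference between `f` and its second order Taylor polynomial at a critical point. -/
noncomputable def quadRemainder (f : E → ℝ) (B : E →L[ℝ] E →L[ℝ] ℝ) (x₀ z : E) : ℝ :=
  f z - f x₀ - 1 / 2 * B (z - x₀) (z - x₀)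

/-- The length by which `straighten` displaces `z` along `L (z - x₀)`. -/
noncomputable def straightenScale (f : E → ℝ) (B : E →L[ℝ] E →L[ℝ] ℝ) (L : E →L[ℝ] E) (x₀ z : E) : ℝ :=
  quadRoot (quadRemainder f B x₀ z / ‖z - x₀‖ ^ 2)
    ((1 / 2 * ⟪z - x₀, L (z - x₀)⟫) / ‖z - x₀‖ ^ 2)

/-- The displacement of `straighten`. -/
noncomputable def straightenDisp (f : E → ℝ) (B : E →L[ℝ] E →L[ℝ] ℝ) (L : E →L[ℝ] E) (x₀ z : E) : E :=
  straightenScale f B L x₀ z • L (z - x₀)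

/-- The coordinate change which turns `f` into its second order Taylor polynomial at `x₀`. -/
noncomputable def straighten (f : E → ℝ) (B : E →L[ℝ] E →L[ℝ] ℝ) (L : E →L[ℝ] E) (x₀ z : E) : E :=
  z + straightenDisp f B L x₀ z

theorem abs_inner_map_le (L : E →L[ℝ] E) (y : E) :
    |1 / 2 * ⟪y, L y⟫| ≤ ‖L‖ / 2 * ‖y‖ ^ 2 := by
  rw [abs_mul, abs_of_pos (by norm_num : (0 : ℝ) < 1 / 2)]
  have := (abs_real_inner_le_norm y (L y)).trans
    (mul_le_mul_of_nonneg_left (L.le_opNorm y) (norm_nonneg y))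
  nlinarith

theorem norm_fderiv_inner_map_le (L : E →L[ℝ] E) (x₀ z : E) :
    ‖fderiv ℝ (fun z => 1 / 2 * ⟪z - x₀, L (z - x₀)⟫) z‖ ≤ ‖L‖ * ‖z - x₀‖ := by
  have h1 := (hasFDerivAt_id (𝕜 := ℝ) z).sub_const x₀
  have h2 := (L.hasFDerivAt (x := z - x₀)).comp z h1
  have h3 := (h1.inner ℝ h2).const_mul (1 / 2 : ℝ)
  have h3' := h3.fderiv
  simp only [id, Function.comp_def] at h3'
  rw [h3']
  refine ContinuousLinearMap.opNorm_le_bound _ (by positivity) fun v => ?_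
  simp only [_root_.smul_apply, ContinuousLinearMap.comp_apply,
    ContinuousLinearMap.prod_apply, fderivInnerCLM_apply, ContinuousLinearMap.id_apply,
    smul_eq_mul, norm_mul, Real.norm_eq_abs]
  have a1 := (abs_real_inner_le_norm (z - x₀) (L v)).trans
    (mul_le_mul_of_nonneg_left (L.le_opNorm v) (norm_nonneg _))
  have a2 := (abs_real_inner_le_norm v (L (z - x₀))).trans
    (mul_le_mul_of_nonneg_left (L.le_opNorm _) (norm_nonneg _))
  have a3 := abs_add_le (⟪z - x₀, L v⟫) (⟪v, L (z - x₀)⟫)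
  rw [abs_of_pos (by norm_num : (0 : ℝ) < 1 / 2)]
  nlinarith

namespace IsNearlyQuadraticOn

variable {f : E → ℝ} {B : E →L[ℝ] E →L[ℝ] ℝ} {L : E →L[ℝ] E} {x₀ z : E} {R ε : ℝ}

theorem eps_nonneg (h : IsNearlyQuadraticOn f B L x₀ R ε) : 0 ≤ ε :=
  (norm_nonneg (fderiv ℝ (fderiv ℝ f) x₀ - B)).trans (h.hessian_close x₀ (mem_ball_self h.pos))

theorem mono (h : IsNearlyQuadraticOn f B L x₀ R ε) {R' ε' : ℝ} (hR : 0 < R') (hR' : R' ≤ R)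
    (hε : ε' ≤ ε) (hc : ∀ x ∈ ball x₀ R', ‖fderiv ℝ (fderiv ℝ f) x - B‖ ≤ ε') :
    IsNearlyQuadraticOn f B L x₀ R' ε' where
  pos := hR
  contDiffOn := h.contDiffOn.mono (ball_subset_ball hR')
  fderiv_center := h.fderiv_center
  hessian_center := h.hessian_center
  dual := h.dual
  hessian_close := hc
  small := le_trans (by gcongr) h.small

theorem contDiffAt (h : IsNearlyQuadraticOn f B L x₀ R ε) (hz : z ∈ ball x₀ R) :
    ContDiffAt ℝ 2 f z := h.contDiffOn.contDiffAt (isOpen_ball.mem_nhds hz)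

theorem symm (h : IsNearlyQuadraticOn f B L x₀ R ε) (u v : E) : B u v = B v u := by
  have := (h.contDiffAt (mem_ball_self h.pos)).isSymmSndFDerivAt (by simp) u v
  rwa [h.hessian_center] at this

theorem hasFDerivAt_quadRemainder (h : IsNearlyQuadraticOn f B L x₀ R ε) (hz : z ∈ ball x₀ R) :
    HasFDerivAt (quadRemainder f B x₀) (fderiv ℝ f z - B (z - x₀)) z := by
  have h1 := ((h.contDiffAt hz).differentiableAt two_ne_zero).hasFDerivAt
  have h2 := (hasFDerivAt_id (𝕜 := ℝ) z).sub_const x₀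
  have h3 := (B.hasFDerivAt (x := z - x₀)).comp z h2
  have h4 := (h1.sub_const (f x₀)).sub ((h3.clm_apply h2).const_mul (1 / 2 : ℝ))
  refine h4.congr_fderiv ?_
  ext v
  have := h.symm v (z - x₀)
  simp only [map_sub, _root_.sub_apply] at this
  simp
  linarith

theorem norm_fderiv_sub_le (h : IsNearlyQuadraticOn f B L x₀ R ε) (hz : z ∈ ball x₀ R) :
    ‖fderiv ℝ f z - B (z - x₀)‖ ≤ ε * ‖z - x₀‖ := by
  have hd : ∀ x ∈ ball x₀ R, HasFDerivWithinAt (fun z => fderiv ℝ f z - B (z - x₀))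
      (fderiv ℝ (fderiv ℝ f) x - B) (ball x₀ R) x := fun x hx => by
    have h1 := (((h.contDiffAt hx).fderiv_right (m := 1) (by norm_num)).differentiableAt
      one_ne_zero).hasFDerivAt
    have h3 := (B.hasFDerivAt (x := x - x₀)).comp x ((hasFDerivAt_id (𝕜 := ℝ) x).sub_const x₀)
    exact (h1.sub h3).hasFDerivWithinAt
  have := (convex_ball x₀ R).norm_image_sub_le_of_norm_hasFDerivWithin_le hd h.hessian_close
    (mem_ball_self h.pos) hz
  simpa [h.fderiv_center] using this

/-- The mean value inequality is applied on the closed ball of radius `‖z - x₀‖`, where the gradient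
bound is uniformly `ε * ‖z - x₀‖`. -/
theorem abs_quadRemainder_le (h : IsNearlyQuadraticOn f B L x₀ R ε) (hz : z ∈ ball x₀ R) :
    |quadRemainder f B x₀ z| ≤ ε * ‖z - x₀‖ ^ 2 := by
  have hsub : closedBall x₀ ‖z - x₀‖ ⊆ ball x₀ R :=
    closedBall_subset_ball (by simpa [dist_eq_norm] using hz)
  have := (convex_closedBall x₀ ‖z - x₀‖).norm_image_sub_le_of_norm_hasFDerivWithin_le
    (fun x hx => (h.hasFDerivAt_quadRemainder (hsub hx)).hasFDerivWithinAt)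
    (C := ε * ‖z - x₀‖) (fun x hx => (h.norm_fderiv_sub_le (hsub hx)).trans
      (mul_le_mul_of_nonneg_left (by simpa [dist_eq_norm] using hx) h.eps_nonneg))
    (mem_closedBall_self (norm_nonneg _)) (y := z) (by simp [dist_eq_norm])
  have h0 : quadRemainder f B x₀ x₀ = 0 := by simp [quadRemainder]
  rw [h0, sub_zero, Real.norm_eq_abs] at this
  linarith

theorem contDiffAt_quadRemainder (h : IsNearlyQuadraticOn f B L x₀ R ε) (hz : z ∈ ball x₀ R) :
    ContDiffAt ℝ 2 (quadRemainder f B x₀) z := by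
  have := h.contDiffAt hz
  unfold quadRemainder
  fun_prop

theorem abs_remainder_div_le (h : IsNearlyQuadraticOn f B L x₀ R ε) (hz : z ∈ ball x₀ R) :
    |quadRemainder f B x₀ z / ‖z - x₀‖ ^ 2| ≤ ε := by
  rw [abs_div, abs_of_nonneg (by positivity : 0 ≤ ‖z - x₀‖ ^ 2)]
  exact div_le_of_le_mul₀ (by positivity) h.eps_nonneg (h.abs_quadRemainder_le hz)

theorem _root_.abs_inner_map_div_le (L : E →L[ℝ] E) (y : E) :
    |(1 / 2 * ⟪y, L y⟫) / ‖y‖ ^ 2| ≤ ‖L‖ / 2 := by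
  rw [abs_div, abs_of_nonneg (by positivity : 0 ≤ ‖y‖ ^ 2)]
  exact div_le_of_le_mul₀ (by positivity) (by positivity) (abs_inner_map_le L y)

theorem discr_pos (h : IsNearlyQuadraticOn f B L x₀ R ε) (hz : z ∈ ball x₀ R) :
    0 < 1 + 4 * (quadRemainder f B x₀ z / ‖z - x₀‖ ^ 2) *
      ((1 / 2 * ⟪z - x₀, L (z - x₀)⟫) / ‖z - x₀‖ ^ 2) := by
  have h1 := mul_le_mul (h.abs_remainder_div_le hz) (abs_inner_map_div_le L (z - x₀))
    (abs_nonneg _) h.eps_nonneg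
  rw [← abs_mul] at h1
  have := h.small
  linarith [neg_le_of_abs_le h1]

theorem abs_straightenScale_le (h : IsNearlyQuadraticOn f B L x₀ R ε) (hz : z ∈ ball x₀ R) :
    |straightenScale f B L x₀ z| ≤ 2 * ε :=
  (abs_quadRoot_le _ _).trans (by linarith [h.abs_remainder_div_le hz])

theorem norm_straightenDisp_le (h : IsNearlyQuadraticOn f B L x₀ R ε) (hz : z ∈ ball x₀ R) :
    ‖straightenDisp f B L x₀ z‖ ≤ 2 * (ε * ‖L‖) * ‖z - x₀‖ := by
  rw [straightenDisp, norm_smul, Real.norm_eq_abs]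
  calc _ ≤ 2 * ε * (‖L‖ * ‖z - x₀‖) :=
        mul_le_mul (h.abs_straightenScale_le hz) (L.le_opNorm _) (norm_nonneg _)
          (by linarith [h.eps_nonneg])
    _ = _ := by ring

theorem contDiffAt_remainder_div (h : IsNearlyQuadraticOn f B L x₀ R ε) (hz : z ∈ ball x₀ R)
    (hne : z ≠ x₀) : ContDiffAt ℝ 1 (fun z => quadRemainder f B x₀ z / ‖z - x₀‖ ^ 2) z :=
  ((h.contDiffAt_quadRemainder hz).of_le (by norm_num)).div
    ((contDiffAt_id.sub contDiffAt_const).norm_sq ℝ) (by simpa [sub_eq_zero] using hne)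

theorem _root_.contDiffAt_inner_map_div (L : E →L[ℝ] E) (hne : z ≠ x₀) :
    ContDiffAt ℝ 1 (fun z => (1 / 2 * ⟪z - x₀, L (z - x₀)⟫) / ‖z - x₀‖ ^ 2) z := by
  refine ContDiffAt.div ?_ ((contDiffAt_id.sub contDiffAt_const).norm_sq ℝ)
    (by simpa [sub_eq_zero] using hne)
  have h1 : ContDiffAt ℝ 1 (fun z : E => z - x₀) z := by fun_prop
  exact contDiffAt_const.mul (h1.inner ℝ (L.contDiff.contDiffAt.comp z h1))

theorem contDiffAt_straightenScale (h : IsNearlyQuadraticOn f B L x₀ R ε) (hz : z ∈ ball x₀ R)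
    (hne : z ≠ x₀) : ContDiffAt ℝ 1 (straightenScale f B L x₀) z :=
  (h.contDiffAt_remainder_div hz hne).quadRoot (contDiffAt_inner_map_div L hne) (h.discr_pos hz)

theorem norm_fderiv_straightenScale_le (h : IsNearlyQuadraticOn f B L x₀ R ε)
    (hz : z ∈ ball x₀ R) (hne : z ≠ x₀) :
    ‖fderiv ℝ (straightenScale f B L x₀) z‖ ≤ 10 * ε / ‖z - x₀‖ := by
  have hs := h.small
  refine norm_fderiv_quadRoot_le (M := ‖L‖) (h.contDiffAt_remainder_div hz hne)
    (contDiffAt_inner_map_div L hne) (norm_pos_iff.2 (sub_ne_zero.2 hne)) h.eps_nonneg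
    (by linarith) (h.abs_remainder_div_le hz) (abs_inner_map_div_le L _) ?_ ?_
  · have := norm_fderiv_div_norm_sq_le hne (h.hasFDerivAt_quadRemainder hz).differentiableAt
      (h.abs_quadRemainder_le hz) (b := ε)
      (by rw [(h.hasFDerivAt_quadRemainder hz).fderiv]; exact h.norm_fderiv_sub_le hz)
    refine this.trans_eq ?_
    ring
  · have hd : DifferentiableAt ℝ (fun z => 1 / 2 * ⟪z - x₀, L (z - x₀)⟫) z := by
      have h1 : DifferentiableAt ℝ (fun z : E => z - x₀) z := by fun_prop
      exact (h1.inner ℝ (L.differentiableAt.comp z h1)).const_mul _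
    have := norm_fderiv_div_norm_sq_le hne hd (abs_inner_map_le L _)
      (norm_fderiv_inner_map_le L x₀ z)
    refine this.trans_eq ?_
    ring

theorem contDiffAt_straightenDisp (h : IsNearlyQuadraticOn f B L x₀ R ε) (hz : z ∈ ball x₀ R)
    (hne : z ≠ x₀) : ContDiffAt ℝ 1 (straightenDisp f B L x₀) z := by
  have h1 : ContDiffAt ℝ 1 (fun z : E => z - x₀) z := by fun_prop
  exact (h.contDiffAt_straightenScale hz hne).smul (L.contDiff.contDiffAt.comp z h1)

/-- In the product rule, `s L` contributes `2ε‖L‖`. In the other term the `1/‖z - x₀‖` growth of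
`Ds` cancels against `‖L (z - x₀)‖`, leaving `10ε‖L‖`. -/
theorem norm_fderiv_straightenDisp_le_of_ne (h : IsNearlyQuadraticOn f B L x₀ R ε)
    (hz : z ∈ ball x₀ R) (hne : z ≠ x₀) :
    ‖fderiv ℝ (straightenDisp f B L x₀) z‖ ≤ 12 * (ε * ‖L‖) := by
  have hs := ((h.contDiffAt_straightenScale hz hne).differentiableAt one_ne_zero).hasFDerivAt
  have hl : HasFDerivAt (fun z => L (z - x₀)) L z :=
    (L.hasFDerivAt (x := z - x₀)).comp z ((hasFDerivAt_id (𝕜 := ℝ) z).sub_const x₀)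
  have hρ : 0 < ‖z - x₀‖ := norm_pos_iff.2 (sub_ne_zero.2 hne)
  have hε := h.eps_nonneg
  have hd : HasFDerivAt (straightenDisp f B L x₀) _ z := hs.smul hl
  rw [hd.fderiv]
  refine (norm_add_le _ _).trans ?_
  rw [norm_smul, ContinuousLinearMap.norm_smulRight_apply, Real.norm_eq_abs]
  calc _ ≤ 2 * ε * ‖L‖ + 10 * ε / ‖z - x₀‖ * (‖L‖ * ‖z - x₀‖) := by
        gcongr
        · exact h.abs_straightenScale_le hz
        · exact h.norm_fderiv_straightenScale_le hz hne
        · exact L.le_opNorm _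
    _ = _ := by field_simp; ring

/-- Near `x₀` the closeness constant can be taken arbitrarily small. -/
theorem exists_small (h : IsNearlyQuadraticOn f B L x₀ R ε) {η : ℝ} (hη : 0 < η) :
    ∃ R' ε', IsNearlyQuadraticOn f B L x₀ R' ε' ∧ 12 * (ε' * ‖L‖) ≤ η := by
  rcases h.eps_nonneg.eq_or_lt with h0 | hε
  · exact ⟨R, ε, h, by simp [← h0, hη.le]⟩
  have hcont : ContinuousAt (fderiv ℝ (fderiv ℝ f)) x₀ :=
    (((h.contDiffAt (mem_ball_self h.pos)).fderiv_right (m := 1) (by norm_num)).fderiv_right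
      (m := 0) (by norm_num)).continuousAt
  -- The `+ 1` keeps the denominator positive when `L = 0`.
  set ε' := min ε (η / (12 * (‖L‖ + 1))) with hε'
  have hε'0 : 0 < ε' := lt_min hε (by positivity)
  have hn : ContinuousAt (fun x => ‖fderiv ℝ (fderiv ℝ f) x - B‖) x₀ := by
    have h0 : ContinuousAt (fun x => fderiv ℝ (fderiv ℝ f) x - B) x₀ := hcont.sub continuousAt_const
    exact ContinuousAt.norm (E := E →L[ℝ] E →L[ℝ] ℝ) h0
  have hn0 : ‖fderiv ℝ (fderiv ℝ f) x₀ - B‖ < ε' := by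
    rw [h.hessian_center, sub_self]
    exact (norm_zero (E := E →L[ℝ] E →L[ℝ] ℝ)).trans_lt hε'0
  obtain ⟨δ, hδ, hball⟩ := Metric.eventually_nhds_iff_ball.1
    (hn.eventually_lt_const (u := ε') hn0)
  refine ⟨min R δ, ε', h.mono (lt_min h.pos hδ) (min_le_left _ _) (min_le_left _ _) ?_, ?_⟩
  · exact fun x hx => (hball x (ball_subset_ball (min_le_right _ _) hx)).le
  · have h1 : ε' ≤ η / (12 * (‖L‖ + 1)) := min_le_right _ _
    rw [le_div_iff₀ (by positivity)] at h1
    nlinarith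

/-- The displacement does not involve `R` or `ε`, so its linear bound holds with arbitrarily small
`ε'` on smaller balls; hence it is `o(‖z - x₀‖)`. -/
theorem hasFDerivAt_straightenDisp_center (h : IsNearlyQuadraticOn f B L x₀ R ε) :
    HasFDerivAt (straightenDisp f B L x₀) (0 : E →L[ℝ] E) x₀ := by
  rw [hasFDerivAt_iff_isLittleO, Asymptotics.isLittleO_iff]
  intro η hη
  obtain ⟨R', ε', h', hs⟩ := h.exists_small hη
  filter_upwards [ball_mem_nhds x₀ h'.pos] with z hz
  have h0 : straightenDisp f B L x₀ x₀ = 0 := by simp [straightenDisp]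
  simp only [h0, sub_zero, _root_.zero_apply]
  refine (h'.norm_straightenDisp_le hz).trans ?_
  have : 0 ≤ ε' * ‖L‖ := mul_nonneg h'.eps_nonneg (norm_nonneg _)
  gcongr
  linarith

theorem norm_fderiv_straightenDisp_le (h : IsNearlyQuadraticOn f B L x₀ R ε)
    (hz : z ∈ ball x₀ R) : ‖fderiv ℝ (straightenDisp f B L x₀) z‖ ≤ 12 * (ε * ‖L‖) := by
  rcases eq_or_ne z x₀ with rfl | hne
  · rw [h.hasFDerivAt_straightenDisp_center.fderiv, norm_zero]
    have := mul_nonneg h.eps_nonneg (norm_nonneg L)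
    positivity
  · exact h.norm_fderiv_straightenDisp_le_of_ne hz hne

theorem differentiableAt_straightenDisp (h : IsNearlyQuadraticOn f B L x₀ R ε)
    (hz : z ∈ ball x₀ R) : DifferentiableAt ℝ (straightenDisp f B L x₀) z := by
  rcases eq_or_ne z x₀ with rfl | hne
  · exact h.hasFDerivAt_straightenDisp_center.differentiableAt
  · exact (h.contDiffAt_straightenDisp hz hne).differentiableAt one_ne_zero

theorem contDiffOn_straightenDisp (h : IsNearlyQuadraticOn f B L x₀ R ε) :
    ContDiffOn ℝ 1 (straightenDisp f B L x₀) (ball x₀ R) := by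
  rw [← zero_add (1 : ℕ∞ω), contDiffOn_succ_iff_fderiv_of_isOpen isOpen_ball]
  refine ⟨fun z hz => (h.differentiableAt_straightenDisp hz).differentiableWithinAt, by simp, ?_⟩
  rw [contDiffOn_zero]
  intro z hz
  refine ContinuousAt.continuousWithinAt ?_
  rcases eq_or_ne z x₀ with rfl | hne
  -- At the centre the derivative is zero, and nearby it is bounded by `12 ε' ‖L‖` with `ε'` as
  -- small as desired.
  · rw [Metric.continuousAt_iff']
    intro η hη
    obtain ⟨R', ε', h', hs⟩ := h.exists_small (half_pos hη)
    filter_upwards [ball_mem_nhds z h'.pos] with x hx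
    rw [h.hasFDerivAt_straightenDisp_center.fderiv, dist_zero_right]
    linarith [h'.norm_fderiv_straightenDisp_le hx]
  · exact ((h.contDiffAt_straightenDisp hz hne).fderiv_right (m := 0) (by norm_num)).continuousAt

/-- `straighten` conjugates the quadratic form of the Hessian to `f`. -/
theorem half_hessian_straighten (h : IsNearlyQuadraticOn f B L x₀ R ε) (hz : z ∈ ball x₀ R) :
    1 / 2 * B (straighten f B L x₀ z - x₀) (straighten f B L x₀ z - x₀) = f z - f x₀ := by
  rcases eq_or_ne z x₀ with rfl | hne
  · simp [straighten, straightenDisp]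
  have hρ : ‖z - x₀‖ ≠ 0 := norm_ne_zero_iff.2 (sub_ne_zero.2 hne)
  have hq := quadRoot_add (h.discr_pos hz).le
  change straightenScale f B L x₀ z + _ * straightenScale f B L x₀ z ^ 2 = _ at hq
  have e : straighten f B L x₀ z - x₀ = (z - x₀) + straightenScale f B L x₀ z • L (z - x₀) := by
    rw [straighten, straightenDisp]; abel
  rw [e]
  generalize straightenScale f B L x₀ z = s at *
  -- Symmetry and duality reduce both cross terms to `‖z - x₀‖²`, leaving the quadratic equation
  -- multiplied by `‖z - x₀‖²`.
  simp only [map_add, map_smul, _root_.add_apply, _root_.smul_apply,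
    smul_eq_mul, h.dual, h.symm (z - x₀) (L (z - x₀)), real_inner_self_eq_norm_sq]
  rw [quadRemainder] at hq
  field_simp at hq
  linarith

end IsNearlyQuadraticOn

end

/-! ### Inverting the straightening map. -/

section

variable {E : Type*} [NormedAddCommGroup E] [InnerProductSpace ℝ E]

open Metric
open scoped RealInnerProductSpace NNReal

/-- The inverse of `straighten`. -/
noncomputable def straightenInv (f : E → ℝ) (B : E →L[ℝ] E →L[ℝ] ℝ) (L : E →L[ℝ] E) (x₀ : E)
    (R : ℝ) : E → E :=
  Function.invFunOn (straighten f B L x₀) (ball x₀ R)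

theorem straighten_center (f : E → ℝ) (B : E →L[ℝ] E →L[ℝ] ℝ) (L : E →L[ℝ] E) (x₀ : E) :
    straighten f B L x₀ x₀ = x₀ := by simp [straighten, straightenDisp]

theorem continuous_quadRoot : Continuous fun p : ℝ × ℝ => quadRoot p.1 p.2 := by
  unfold quadRoot
  refine Continuous.div (by fun_prop) (by fun_prop) fun p => ?_
  positivity

/-- The smallness condition for inverting a `1/2`-Lipschitz perturbation of the identity. -/
theorem half_lt_inv_nnnorm_refl_symm (E : Type*) [NormedAddCommGroup E] [InnerProductSpace ℝ E] :
    Subsingleton E ∨ (1 / 2 : ℝ≥0) <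
      ‖((ContinuousLinearEquiv.refl ℝ E).symm : E →L[ℝ] E)‖₊⁻¹ := by
  rcases subsingleton_or_nontrivial E with hE | hE
  · exact Or.inl hE
  · right
    have : ‖((ContinuousLinearEquiv.refl ℝ E).symm : E →L[ℝ] E)‖₊ = 1 :=
      NNReal.eq (ContinuousLinearMap.norm_id (𝕜 := ℝ) (E := E))
    rw [this, inv_one, ← NNReal.coe_lt_coe]
    norm_num

namespace IsNearlyQuadraticOn

variable {f : E → ℝ} {B : E →L[ℝ] E →L[ℝ] ℝ} {L : E →L[ℝ] E} {x₀ x y z : E} {R ε : ℝ}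

/-- The constant `24` in `small` is chosen so that the derivative bound `12ε‖L‖` is at most `1/2`.
-/
theorem norm_straightenDisp_sub_le (h : IsNearlyQuadraticOn f B L x₀ R ε) (hx : x ∈ ball x₀ R)
    (hy : y ∈ ball x₀ R) :
    ‖straightenDisp f B L x₀ x - straightenDisp f B L x₀ y‖ ≤ 1 / 2 * ‖x - y‖ :=
  (convex_ball x₀ R).norm_image_sub_le_of_norm_fderiv_le
    (fun z hz => h.differentiableAt_straightenDisp hz)
    (fun z hz => (h.norm_fderiv_straightenDisp_le hz).trans (by linarith [h.small])) hy hx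

theorem approximatesLinearOn (h : IsNearlyQuadraticOn f B L x₀ R ε) :
    ApproximatesLinearOn (straighten f B L x₀) (ContinuousLinearEquiv.refl ℝ E : E →L[ℝ] E)
      (ball x₀ R) (1 / 2 : ℝ≥0) := by
  intro x hx y hy
  have := h.norm_straightenDisp_sub_le hx hy
  simp only [straighten]
  convert! this using 2
  simp; abel

theorem dist_le_two_mul (h : IsNearlyQuadraticOn f B L x₀ R ε) (hx : x ∈ ball x₀ R)
    (hy : y ∈ ball x₀ R) :
    dist x y ≤ 2 * dist (straighten f B L x₀ x) (straighten f B L x₀ y) := by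
  have h1 := h.norm_straightenDisp_sub_le hx hy
  have e : x - y = (straighten f B L x₀ x - straighten f B L x₀ y)
      - (straightenDisp f B L x₀ x - straightenDisp f B L x₀ y) := by
    simp only [straighten]; abel
  have h2 := norm_sub_le (straighten f B L x₀ x - straighten f B L x₀ y)
    (straightenDisp f B L x₀ x - straightenDisp f B L x₀ y)
  rw [← e] at h2
  rw [dist_eq_norm, dist_eq_norm]
  linarith

theorem dist_straighten_le (h : IsNearlyQuadraticOn f B L x₀ R ε) (hx : x ∈ ball x₀ R)
    (hy : y ∈ ball x₀ R) :
    dist (straighten f B L x₀ x) (straighten f B L x₀ y) ≤ 2 * dist x y := by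
  have h1 := h.norm_straightenDisp_sub_le hx hy
  have e : straighten f B L x₀ x - straighten f B L x₀ y = (x - y)
      + (straightenDisp f B L x₀ x - straightenDisp f B L x₀ y) := by
    simp only [straighten]; abel
  have h2 := norm_add_le (x - y) (straightenDisp f B L x₀ x - straightenDisp f B L x₀ y)
  rw [← e] at h2
  rw [dist_eq_norm, dist_eq_norm]
  linarith [norm_nonneg (x - y)]

theorem injOn_straighten (h : IsNearlyQuadraticOn f B L x₀ R ε) :
    InjOn (straighten f B L x₀) (ball x₀ R) := fun x hx y hy hxy => by
  have := h.dist_le_two_mul hx hy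
  rw [hxy, dist_self, mul_zero] at this
  exact dist_le_zero.1 this

theorem straightenInv_straighten (h : IsNearlyQuadraticOn f B L x₀ R ε) (hz : z ∈ ball x₀ R) :
    straightenInv f B L x₀ R (straighten f B L x₀ z) = z :=
  h.injOn_straighten.leftInvOn_invFunOn hz

theorem straightenInv_center (h : IsNearlyQuadraticOn f B L x₀ R ε) :
    straightenInv f B L x₀ R x₀ = x₀ := by
  simpa only [straighten_center] using h.straightenInv_straighten (mem_ball_self h.pos)

theorem contDiffOn_straighten (h : IsNearlyQuadraticOn f B L x₀ R ε) :
    ContDiffOn ℝ 1 (straighten f B L x₀) (ball x₀ R) :=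
  contDiffOn_id.add h.contDiffOn_straightenDisp

section Complete

variable [CompleteSpace E]

/-- Quantitative surjectivity of a `1/2`-Lipschitz perturbation of the identity: the closed ball of
radius `R/2` covers one of radius `(1 - 1/2) * R/2`. The trivial space is separate because its
identity has norm `0`. -/
theorem closedBall_subset_image (h : IsNearlyQuadraticOn f B L x₀ R ε) :
    closedBall x₀ (R / 4) ⊆ straighten f B L x₀ '' ball x₀ R := by
  rcases subsingleton_or_nontrivial E with hE | hE
  · intro x _
    exact ⟨x₀, mem_ball_self h.pos, Subsingleton.elim _ _⟩
  have h1 := h.approximatesLinearOn.closedBall_subset_target (half_lt_inv_nnnorm_refl_symm E) isOpen_ball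
    (b := x₀) (ε := R / 2) (by linarith [h.pos]) (closedBall_subset_ball (by linarith [h.pos]))
  rw [straighten_center] at h1
  refine (closedBall_subset_closedBall ?_).trans h1
  have : ‖((ContinuousLinearEquiv.refl ℝ E).symm : E →L[ℝ] E)‖₊ = 1 :=
    NNReal.eq (ContinuousLinearMap.norm_id (𝕜 := ℝ) (E := E))
  rw [this]
  push_cast
  linarith

theorem straightenInv_mem (h : IsNearlyQuadraticOn f B L x₀ R ε)
    (hx : x ∈ closedBall x₀ (R / 4)) : straightenInv f B L x₀ R x ∈ ball x₀ R :=
  Function.invFunOn_mem (h.closedBall_subset_image hx)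

theorem straighten_straightenInv (h : IsNearlyQuadraticOn f B L x₀ R ε)
    (hx : x ∈ closedBall x₀ (R / 4)) :
    straighten f B L x₀ (straightenInv f B L x₀ R x) = x :=
  Function.invFunOn_eq (h.closedBall_subset_image hx)

theorem apply_straightenInv (h : IsNearlyQuadraticOn f B L x₀ R ε)
    (hx : x ∈ closedBall x₀ (R / 4)) :
    f (straightenInv f B L x₀ R x) = f x₀ + 1 / 2 * B (x - x₀) (x - x₀) := by
  have := h.half_hessian_straighten (h.straightenInv_mem hx)
  rw [h.straighten_straightenInv hx] at this
  linarith

theorem lipschitzOnWith_straightenInv (h : IsNearlyQuadraticOn f B L x₀ R ε) :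
    LipschitzOnWith 2 (straightenInv f B L x₀ R) (closedBall x₀ (R / 4)) := by
  refine LipschitzOnWith.of_dist_le_mul fun x hx y hy => ?_
  have := h.dist_le_two_mul (h.straightenInv_mem hx) (h.straightenInv_mem hy)
  rwa [h.straighten_straightenInv hx, h.straighten_straightenInv hy] at this

/-- The derivative of the straightening map is the identity plus an operator of norm below `1`,
hence a unit by the Neumann series, so the inverse function theorem applies at every point. -/
theorem contDiffAt_straightenInv (h : IsNearlyQuadraticOn f B L x₀ R ε)
    (hx : x ∈ closedBall x₀ (R / 4)) : ContDiffAt ℝ 1 (straightenInv f B L x₀ R) x := by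
  set e := h.approximatesLinearOn.toOpenPartialHomeomorph _ _ (half_lt_inv_nnnorm_refl_symm E) isOpen_ball with he
  have hes : (e.symm : E → E) = straightenInv f B L x₀ R := rfl
  have hmem := h.straightenInv_mem hx
  have hd := (h.differentiableAt_straightenDisp hmem).hasFDerivAt
  have hn : ‖-fderiv ℝ (straightenDisp f B L x₀) (straightenInv f B L x₀ R x)‖ < 1 := by
    rw [norm_neg]
    linarith [h.norm_fderiv_straightenDisp_le hmem, h.small]
  have hdd : HasFDerivAt e ((ContinuousLinearEquiv.unitsEquiv ℝ E (Units.oneSub _ hn) : E ≃L[ℝ] E)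
      : E →L[ℝ] E) (e.symm x) := by
    have : HasFDerivAt (straighten f B L x₀) _ (straightenInv f B L x₀ R x) :=
      (hasFDerivAt_id _).add hd
    refine this.congr_fderiv ?_
    ext v
    simp [ContinuousLinearEquiv.unitsEquiv_apply]
  have hx' : x ∈ e.target := h.closedBall_subset_image hx
  exact e.contDiffAt_symm hx' hdd
    (h.contDiffOn_straighten.contDiffAt (isOpen_ball.mem_nhds hmem))

theorem isBiLipschitzDiffeoOn_straightenInv (h : IsNearlyQuadraticOn f B L x₀ R ε) :
    IsBiLipschitzDiffeoOn (straightenInv f B L x₀ R) (closedBall x₀ (R / 4)) := by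
  refine ⟨⟨2, h.lipschitzOnWith_straightenInv⟩, ⟨2, ?_⟩,
    fun x hx => (h.contDiffAt_straightenInv hx).contDiffWithinAt, straighten f B L x₀,
    fun x hx => h.straighten_straightenInv hx, h.contDiffOn_straighten.mono ?_⟩
  · refine AntilipschitzWith.of_le_mul_dist fun x y => ?_
    have := h.dist_straighten_le (h.straightenInv_mem x.2) (h.straightenInv_mem y.2)
    rwa [h.straighten_straightenInv x.2, h.straighten_straightenInv y.2] at this
  · rintro _ ⟨x, hx, rfl⟩
    exact h.straightenInv_mem hx

end Complete

end IsNearlyQuadraticOn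

/-! ### Convergence of the straightening maps and their inverses. -/

/-- Pointwise convergence of equi-Lipschitz functions on a compact set is uniform. -/
theorem tendstoUniformlyOn_of_lipschitzOnWith {X Y : Type*} [PseudoMetricSpace X]
    [PseudoMetricSpace Y] {G : ℕ → X → Y} {g : X → Y} {K : Set X} {C : ℝ≥0} (hK : IsCompact K)
    (hG : ∀ᶠ n in atTop, LipschitzOnWith C (G n) K) (hg : ContinuousOn g K)
    (hlim : ∀ x ∈ K, Tendsto (fun n => G n x) atTop (𝓝 (g x))) :
    TendstoUniformlyOn G g atTop K := by
  rw [← tendstoLocallyUniformlyOn_iff_tendstoUniformlyOn_of_compact hK,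
    Metric.tendstoLocallyUniformlyOn_iff]
  intro η hη x hx
  have hδ : 0 < η / (3 * (C + 1)) := by positivity
  refine ⟨{y | dist (g y) (g x) < η / 3} ∩ (ball x (η / (3 * (C + 1))) ∩ K), ?_, ?_⟩
  · refine inter_mem ?_ (inter_mem (mem_nhdsWithin_of_mem_nhds (ball_mem_nhds _ hδ))
      self_mem_nhdsWithin)
    exact Metric.continuousWithinAt_iff'.1 (hg x hx) _ (by positivity)
  · filter_upwards [hG, Metric.tendsto_nhds.1 (hlim x hx) (η / 3) (by positivity)] with n hn hn'
    rintro y ⟨hy1, hy2, hy3⟩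
    have h1 := hn.dist_le_mul x hx y hy3
    have h2 : (C : ℝ) * dist x y ≤ η / 3 := by
      rw [mem_ball', lt_div_iff₀ (by positivity)] at hy2
      nlinarith [dist_nonneg (x := x) (y := y), C.coe_nonneg]
    have h3 := dist_triangle4 (g y) (g x) (G n x) (G n y)
    rw [dist_comm (g x)] at h3
    simp only [mem_ofPred_eq] at hy1
    linarith

theorem tendsto_clm_apply {V W : Type*} [NormedAddCommGroup V] [NormedSpace ℝ V]
    [NormedAddCommGroup W] [NormedSpace ℝ W] {A' : ℕ → V →L[ℝ] W} {A : V →L[ℝ] W} {v' : ℕ → V} {v : V}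
    (hA : Tendsto A' atTop (𝓝 A)) (hv : Tendsto v' atTop (𝓝 v)) :
    Tendsto (fun n => A' n (v' n)) atTop (𝓝 (A v)) :=
  (isBoundedBilinearMap_apply.continuous.tendsto (A, v)).comp (hA.prodMk_nhds hv)

section Sequences

variable {F : ℕ → E → ℝ} {B' : ℕ → E →L[ℝ] E →L[ℝ] ℝ} {L' : ℕ → E →L[ℝ] E} {x' : ℕ → E}
  {f : E → ℝ} {B : E →L[ℝ] E →L[ℝ] ℝ} {L : E →L[ℝ] E} {x₀ x z : E} {R ε : ℝ}

/-- Away from `x₀` the explicit formula is continuous in all its data. At `z = x₀` the quotients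
have no limit to rely on, and the uniform bound of the displacement by `‖z - x' n‖` replaces them.
-/
theorem tendsto_straighten (hR : 0 < R)
    (h : ∀ᶠ n in atTop, IsNearlyQuadraticOn (F n) (B' n) (L' n) (x' n) R ε)
    (hx : Tendsto x' atTop (𝓝 x₀)) (hB : Tendsto B' atTop (𝓝 B)) (hL : Tendsto L' atTop (𝓝 L))
    (hF₀ : Tendsto (fun n => F n (x' n)) atTop (𝓝 (f x₀)))
    (hF : Tendsto (fun n => F n z) atTop (𝓝 (f z))) :
    Tendsto (fun n => straighten (F n) (B' n) (L' n) (x' n) z) atTop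
      (𝓝 (straighten f B L x₀ z)) := by
  refine tendsto_const_nhds.add ?_
  have hy : Tendsto (fun n => z - x' n) atTop (𝓝 (z - x₀)) := tendsto_const_nhds.sub hx
  have hLy : Tendsto (fun n => L' n (z - x' n)) atTop (𝓝 (L (z - x₀))) := tendsto_clm_apply hL hy
  rcases eq_or_ne z x₀ with rfl | hne
  · have e : straightenDisp f B L z z = 0 := by simp [straightenDisp]
    rw [e]
    rw [sub_self] at hy
    refine squeeze_zero_norm' ?_ (tendsto_zero_iff_norm_tendsto_zero.1 hy)
    filter_upwards [h, hx.eventually (ball_mem_nhds z hR)] with n hn hn'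
    refine (hn.norm_straightenDisp_le (mem_ball_comm.1 hn')).trans ?_
    nlinarith [hn.small, norm_nonneg (z - x' n)]
  · have hN : Tendsto (fun n => ‖z - x' n‖ ^ 2) atTop (𝓝 (‖z - x₀‖ ^ 2)) := hy.norm.pow 2
    have hN0 : ‖z - x₀‖ ^ 2 ≠ 0 := by simpa [sub_eq_zero] using hne
    have hw := ((hF.sub hF₀).sub ((tendsto_clm_apply (tendsto_clm_apply hB hy) hy).const_mul (1 / 2 : ℝ))).div hN hN0
    have hc := ((hy.inner hLy).const_mul (1 / 2 : ℝ)).div hN hN0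
    exact ((continuous_quadRoot.tendsto _).comp (hw.prodMk_nhds hc)).smul hLy

/-- With `y` the limiting preimage of `x`, the distance from the `n`-th preimage to `y` is at most
twice the distance from `x` to the `n`-th image of `y`. -/
theorem tendsto_straightenInv [CompleteSpace E] (h₀ : IsNearlyQuadraticOn f B L x₀ R ε)
    (h : ∀ᶠ n in atTop, IsNearlyQuadraticOn (F n) (B' n) (L' n) (x' n) R ε)
    (hx : Tendsto x' atTop (𝓝 x₀)) (hB : Tendsto B' atTop (𝓝 B)) (hL : Tendsto L' atTop (𝓝 L))
    (hF₀ : Tendsto (fun n => F n (x' n)) atTop (𝓝 (f x₀)))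
    (hF : ∀ z ∈ ball x₀ R, Tendsto (fun n => F n z) atTop (𝓝 (f z)))
    (hxR : x ∈ ball x₀ (R / 4)) :
    Tendsto (fun n => straightenInv (F n) (B' n) (L' n) (x' n) R x) atTop
      (𝓝 (straightenInv f B L x₀ R x)) := by
  have hxc := ball_subset_closedBall hxR
  set y := straightenInv f B L x₀ R x with hy
  have hyR : y ∈ ball x₀ R := h₀.straightenInv_mem hxc
  have hlim := tendsto_straighten h₀.pos h hx hB hL hF₀ (hF y hyR)
  rw [h₀.straighten_straightenInv hxc, tendsto_iff_dist_tendsto_zero] at hlim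
  rw [tendsto_iff_dist_tendsto_zero]
  have hlim2 := hlim.const_mul 2
  rw [mul_zero] at hlim2
  have ev1 : ∀ᶠ n in atTop, dist x (x' n) < R / 4 :=
    (tendsto_const_nhds.dist hx).eventually_lt_const hxR
  have ev2 : ∀ᶠ n in atTop, dist y (x' n) < R :=
    (tendsto_const_nhds.dist hx).eventually_lt_const hyR
  refine squeeze_zero' (Eventually.of_forall fun _ => dist_nonneg) ?_ hlim2
  filter_upwards [h, ev1, ev2] with n hn h1 h2
  have := hn.dist_le_two_mul (hn.straightenInv_mem (mem_closedBall.2 h1.le)) (mem_ball.2 h2)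
  rwa [hn.straighten_straightenInv (mem_closedBall.2 h1.le), dist_comm x] at this

theorem tendstoUniformlyOn_straightenInv [ProperSpace E] (h₀ : IsNearlyQuadraticOn f B L x₀ R ε)
    (h : ∀ᶠ n in atTop, IsNearlyQuadraticOn (F n) (B' n) (L' n) (x' n) R ε)
    (hx : Tendsto x' atTop (𝓝 x₀)) (hB : Tendsto B' atTop (𝓝 B)) (hL : Tendsto L' atTop (𝓝 L))
    (hF₀ : Tendsto (fun n => F n (x' n)) atTop (𝓝 (f x₀)))
    (hF : ∀ z ∈ ball x₀ R, Tendsto (fun n => F n z) atTop (𝓝 (f z))) :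
    TendstoUniformlyOn (fun n => straightenInv (F n) (B' n) (L' n) (x' n) R)
      (straightenInv f B L x₀ R) atTop (closedBall x₀ (R / 8)) := by
  have hR := h₀.pos
  refine tendstoUniformlyOn_of_lipschitzOnWith (C := 2) (isCompact_closedBall _ _) ?_
    (h₀.lipschitzOnWith_straightenInv.continuousOn.mono
      (closedBall_subset_closedBall (by linarith))) fun x hxK =>
    tendsto_straightenInv h₀ h hx hB hL hF₀ hF (closedBall_subset_ball (by linarith) hxK)
  -- Once the centres are within `R/8`, the fixed ball of radius `R/8` lies in the moving ball of
  -- radius `R/4`.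
  filter_upwards [h, hx.eventually (ball_mem_nhds x₀ (by linarith : 0 < R / 8))] with n hn hn'
  refine hn.lipschitzOnWith_straightenInv.mono (closedBall_subset_closedBall' ?_)
  rw [dist_comm]
  linarith [mem_ball.1 hn']

end Sequences

end

/-! ### Nondegenerate Hessians and the choice of common constants. -/

section

variable {E : Type*} [NormedAddCommGroup E] [InnerProductSpace ℝ E]

open Metric
open scoped RealInnerProductSpace NNReal

variable (E) in
/-- The inner product as a continuous linear map to the dual. -/
noncomputable def innerDual : E →L[ℝ] E →L[ℝ] ℝ :=
  (isBoundedBilinearMap_inner (𝕜 := ℝ) (E := E)).toContinuousLinearMap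

theorem innerDual_apply (y v : E) : innerDual E y v = ⟪y, v⟫ := rfl

/-- The inverse of a bilinear form, seen as an endomorphism through the inner product. -/
noncomputable def rieszInverse (B : E →L[ℝ] E →L[ℝ] ℝ) : E →L[ℝ] E :=
  B.inverse ∘L innerDual E

theorem rieszInverse_dual {B : E →L[ℝ] E →L[ℝ] ℝ} (hB : B.IsInvertible) (y v : E) :
    B (rieszInverse B y) v = ⟪y, v⟫ := by
  simp only [rieszInverse, ContinuousLinearMap.comp_apply, hB.self_apply_inverse]
  exact innerDual_apply y v

theorem tendsto_rieszInverse [CompleteSpace E] {B : E →L[ℝ] E →L[ℝ] ℝ}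
    {B' : ℕ → E →L[ℝ] E →L[ℝ] ℝ} (hB : B.IsInvertible) (h : Tendsto B' atTop (𝓝 B)) :
    Tendsto (fun n => rieszInverse (B' n)) atTop (𝓝 (rieszInverse B)) := by
  have h1 : ContinuousAt (fun A : E →L[ℝ] E →L[ℝ] ℝ => A.inverse) B :=
    (hB.contDiffAt_map_inverse (n := 0)).continuousAt
  have h2 : Tendsto (fun n => (B' n).inverse) atTop (𝓝 B.inverse) := h1.tendsto.comp h
  exact ((ContinuousLinearMap.compL ℝ E (E →L[ℝ] ℝ) E).flip (innerDual E)).continuous.tendsto _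
    |>.comp h2

/-- The second derivative as a bilinear form. -/
noncomputable def hess (f : E → ℝ) (x : E) : E →L[ℝ] E →L[ℝ] ℝ := fderiv ℝ (fderiv ℝ f) x

/-- The coordinate change of the Morse lemma for `f` at `x₀`. -/
noncomputable def morseChange (f : E → ℝ) (x₀ : E) (R : ℝ) : E → E :=
  straightenInv f (hess f x₀) (rieszInverse (hess f x₀)) x₀ R

theorem isNearlyQuadraticOn_hess {f : E → ℝ} {x₀ : E} {R ε : ℝ} (hR : 0 < R)
    (hf : ContDiffOn ℝ 2 f (ball x₀ R)) (hc : fderiv ℝ f x₀ = 0) (hB : (hess f x₀).IsInvertible)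
    (hε : ∀ x ∈ ball x₀ R, dist (hess f x) (hess f x₀) ≤ ε)
    (hs : 24 * (ε * ‖rieszInverse (hess f x₀)‖) ≤ 1) :
    IsNearlyQuadraticOn f (hess f x₀) (rieszInverse (hess f x₀)) x₀ R ε where
  pos := hR
  contDiffOn := hf
  fderiv_center := hc
  hessian_center := rfl
  dual := rieszInverse_dual hB
  hessian_close x hx := by
    have := hε x hx
    rwa [dist_eq_norm (E := E →L[ℝ] E →L[ℝ] ℝ)] at this
  small := hs

theorem continuousAt_hess {f : E → ℝ} {x : E} (hf : ContDiffAt ℝ 2 f x) :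
    ContinuousAt (hess f) x :=
  ((hf.fderiv_right (m := 1) (by norm_num)).fderiv_right (m := 0) (by norm_num)).continuousAt

theorem tendstoUniformlyOn_hess {F : ℕ → E → ℝ} {f : E → ℝ} {K : Set E}
    (h : TendstoUniformlyOn (fun n => iteratedFDeriv ℝ 2 (F n)) (iteratedFDeriv ℝ 2 f) atTop K) :
    TendstoUniformlyOn (fun n => hess (F n)) (hess f) atTop K := by
  rw [Metric.tendstoUniformlyOn_iff] at h
  refine (Metric.tendstoUniformlyOn_iff (α := E →L[ℝ] E →L[ℝ] ℝ)).2 fun η hη => ?_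
  filter_upwards [h η hη] with n hn x hx
  refine lt_of_le_of_lt ?_ (hn x hx)
  rw [dist_eq_norm, dist_eq_norm (E := E →L[ℝ] E →L[ℝ] ℝ)]
  refine ContinuousLinearMap.opNorm_le_bound₂ _ (norm_nonneg _) fun u v => ?_
  have := (iteratedFDeriv ℝ 2 f x - iteratedFDeriv ℝ 2 (F n) x).le_opNorm ![u, v]
  simpa [iteratedFDeriv_two_apply, Fin.prod_univ_two, hess, mul_assoc] using this

variable {F : ℕ → E → ℝ} {f : E → ℝ} {x' : ℕ → E} {x₀ : E}

/-- A single `C²` function is nearly quadratic on small balls about a nondegenerate critical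
point. -/
theorem exists_isNearlyQuadraticOn {R₀ : ℝ} (hR₀ : 0 < R₀)
    (hf : ContDiffOn ℝ 2 f (ball x₀ R₀)) (hc : fderiv ℝ f x₀ = 0)
    (hB : (hess f x₀).IsInvertible) :
    ∃ R ε, R ≤ R₀ ∧ IsNearlyQuadraticOn f (hess f x₀) (rieszInverse (hess f x₀)) x₀ R ε := by
  set M := ‖rieszInverse (hess f x₀)‖
  set ε := 1 / (24 * (M + 1))
  have hM : 0 ≤ M := norm_nonneg _
  have hε : 0 < ε := by positivity
  obtain ⟨δ, hδ, hd⟩ := Metric.eventually_nhds_iff_ball.1 ((Metric.tendsto_nhds (α := E →L[ℝ] E →L[ℝ] ℝ)).1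
    (continuousAt_hess (hf.contDiffAt (ball_mem_nhds x₀ hR₀))).tendsto ε hε)
  refine ⟨min R₀ δ, ε, min_le_left _ _, isNearlyQuadraticOn_hess (lt_min hR₀ hδ)
    (hf.mono (ball_subset_ball (min_le_left _ _))) hc hB
    (fun x hx => (hd x (ball_subset_ball (min_le_right _ _) hx)).le) ?_⟩
  have : ε * (24 * (M + 1)) = 1 := by simp only [ε]; field_simp
  nlinarith

/-- If `F n → f` in `C²` near `x₀` and the nondegenerate critical points `x' n` of `F n` tend to
`x₀`, then the `F n` are eventually nearly quadratic on balls of a common radius. -/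
theorem exists_isNearlyQuadraticOn_seq [CompleteSpace E] {R₀ : ℝ} (hR₀ : 0 < R₀)
    (hf : ContDiffOn ℝ 2 f (ball x₀ R₀)) (hc : fderiv ℝ f x₀ = 0)
    (hB : (hess f x₀).IsInvertible) (hF : ∀ n, ContDiffOn ℝ 2 (F n) (ball x₀ R₀))
    (hFc : ∀ᶠ n in atTop, fderiv ℝ (F n) (x' n) = 0)
    (hFB : ∀ᶠ n in atTop, (hess (F n) (x' n)).IsInvertible)
    (hx : Tendsto x' atTop (𝓝 x₀))
    (h2 : TendstoUniformlyOn (fun n => hess (F n)) (hess f) atTop (ball x₀ R₀)) :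
    ∃ R ε, 2 * R ≤ R₀ ∧
      IsNearlyQuadraticOn f (hess f x₀) (rieszInverse (hess f x₀)) x₀ R ε ∧
      (∀ᶠ n in atTop, IsNearlyQuadraticOn (F n) (hess (F n) (x' n))
        (rieszInverse (hess (F n) (x' n))) (x' n) R ε) ∧
      Tendsto (fun n => hess (F n) (x' n)) atTop (𝓝 (hess f x₀)) := by
  have hcont := continuousAt_hess (hf.contDiffAt (ball_mem_nhds x₀ hR₀))
  have hlim : Tendsto (fun n => hess (F n) (x' n)) atTop (𝓝 (hess f x₀)) :=
    h2.tendsto_comp hcont.continuousWithinAt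
      (tendsto_nhdsWithin_iff.2 ⟨hx, hx.eventually (ball_mem_nhds x₀ hR₀)⟩)
  have hL := tendsto_rieszInverse hB hlim
  set M := ‖rieszInverse (hess f x₀)‖ with hMdef
  -- Since the inverses converge, `M + 1` eventually bounds their norms, so this one `ε` meets the
  -- smallness condition for the limit and the sequence.
  set ε := 1 / (24 * (M + 1)) with hεdef
  have hM : 0 ≤ M := norm_nonneg _
  have hε : 0 < ε := by positivity
  have hε1 : 24 * (ε * (M + 1)) = 1 := by simp only [ε]; field_simp
  obtain ⟨δ, hδ, hd⟩ := Metric.eventually_nhds_iff_ball.1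
    ((Metric.tendsto_nhds (α := E →L[ℝ] E →L[ℝ] ℝ)).1 hcont.tendsto (ε / 3) (by positivity))
  -- Halving the radius keeps balls about nearby `x' n` inside the ball about `x₀`, where the
  -- Hessian estimates hold.
  have hR : 0 < min R₀ δ / 2 := by have := lt_min hR₀ hδ; positivity
  have hsub₁ : ball x₀ (min R₀ δ) ⊆ ball x₀ R₀ := ball_subset_ball (min_le_left _ _)
  have hsub₂ : ball x₀ (min R₀ δ) ⊆ ball x₀ δ := ball_subset_ball (min_le_right _ _)
  have hsub₀ : ball x₀ (min R₀ δ / 2) ⊆ ball x₀ (min R₀ δ) := ball_subset_ball (by linarith)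
  refine ⟨min R₀ δ / 2, ε, by linarith [min_le_left R₀ δ], ?_, ?_, hlim⟩
  · refine isNearlyQuadraticOn_hess hR (hf.mono (hsub₀.trans hsub₁)) hc hB
      (fun x hx => (hd x (hsub₂ (hsub₀ hx))).le.trans (by linarith)) ?_
    nlinarith
  · filter_upwards [hFc, hFB, hx.eventually (ball_mem_nhds x₀ hR),
      (Metric.tendstoUniformlyOn_iff (α := E →L[ℝ] E →L[ℝ] ℝ)).1 h2 (ε / 3) (by positivity),
      (Metric.tendsto_nhds (α := E →L[ℝ] E →L[ℝ] ℝ)).1 hlim (ε / 3) (by positivity),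
      hL.norm.eventually_lt_const (u := M + 1) (by linarith)] with n h1 h2 h3 h4 h5 h6
    have hsub : ball (x' n) (min R₀ δ / 2) ⊆ ball x₀ (min R₀ δ) :=
      ball_subset_ball' (by linarith [mem_ball.1 h3])
    refine isNearlyQuadraticOn_hess hR ((hF n).mono (hsub.trans hsub₁)) h1 h2 (fun x hx => ?_) ?_
    · have e1 := (h4 x (hsub₁ (hsub hx))).le
      have e2 := (hd x (hsub₂ (hsub hx))).le
      -- Three errors of `ε/3`: uniform convergence at `x`, continuity of the limiting Hessian, and
      -- convergence at the critical points.
      have e3 := dist_triangle4 (hess (F n) x) (hess f x) (hess f x₀) (hess (F n) (x' n))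
      rw [dist_comm] at e1 h5
      linarith
    · have : ε * ‖rieszInverse (hess (F n) (x' n))‖ ≤ ε * (M + 1) := by gcongr
      linarith

end

/-! ### Passage to a chart. -/

section

open Metric

variable {D : ℕ} {H : Type*} [TopologicalSpace H]
  {I : ModelWithCorners ℝ (EuclideanSpace ℝ (Fin D)) H}
  {S : Type*} [TopologicalSpace S] {n : ℕ∞ω}
  {φ e e' : OpenPartialHomeomorph S H} {f : S → ℝ} {p : S}

open ModelWithCorners in
/-- Being sent to the interior of the model is independent of the chart of the maximal atlas. -/
theorem mem_interior_extend_target_of_mem_maximalAtlas [ChartedSpace H S] [IsManifold I n S] (hn : n ≠ 0)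
    (he : e ∈ IsManifold.maximalAtlas I n S) (he' : e' ∈ IsManifold.maximalAtlas I n S)
    (hex : p ∈ e.source) (hex' : p ∈ e'.source)
    (hx : e.extend I p ∈ interior (e.extend I).target) :
    e'.extend I p ∈ interior (e'.extend I).target := by
  let ψ := I.extendCoordChange e e'
  have hψ : ContDiffOn ℝ n ψ ψ.source := contDiffOn_extendCoordChange he he'
  have hsurj : Function.Surjective (fderivWithin ℝ ψ ψ.source (e.extend I p)) :=
    (isInvertible_fderivWithin_extendCoordChange hn he he' <| by simp [hex, hex']).surjective
  have hψx : ψ.source ∈ 𝓝 (e.extend I p) := by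
    simp_rw [ψ, extendCoordChange, PartialEquiv.trans_source, PartialEquiv.symm_source,
      Filter.inter_mem_iff, mem_interior_iff_mem_nhds.1 hx, true_and, e'.extend_source]
    exact e.extend_preimage_mem_nhds hex <| e'.open_source.mem_nhds hex'
  rw [fderivWithin_of_mem_nhds hψx] at hsurj
  refine e'.mem_interior_extend_target (by simp [hex']) ?_
  change e'.extend I p ∈ _
  rw [show e'.extend I p = ψ (e.extend I p) by simp [ψ, hex]]
  -- A map into the convex model range whose derivative is surjective at a point sends that point to
  -- the interior of the range.
  exact ((hψ.differentiableOn hn).differentiableAt hψx).mem_interior_convex_of_surjective_fderiv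
    hψx I.convex_range I.isClosed_range I.nonempty_interior
    (ψ.mapsTo.mono_right <| by simp [ψ, extendCoordChange, inter_assoc]) hsurj

theorem isInteriorPoint_iff_of_mem_maximalAtlas [ChartedSpace H S] [IsManifold I n S] (hn : n ≠ 0)
    (he : e ∈ IsManifold.maximalAtlas I n S) (hp : p ∈ e.source) :
    I.IsInteriorPoint p ↔ e.extend I p ∈ interior (e.extend I).target := by
  rw [ModelWithCorners.isInteriorPoint_iff]
  have hc := IsManifold.chart_mem_maximalAtlas (I := I) (n := n) p
  exact ⟨mem_interior_extend_target_of_mem_maximalAtlas hn hc he (mem_chart_source H p) hp,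
    mem_interior_extend_target_of_mem_maximalAtlas hn he hc hp (mem_chart_source H p)⟩

theorem contDiffOn_comp_extend_symm [ChartedSpace H S] [IsManifold I 2 S] (hφ : φ ∈ IsManifold.maximalAtlas I 2 S)
    (hf : ContMDiff I 𝓘(ℝ, ℝ) 2 f) :
    ContDiffOn ℝ 2 (f ∘ (φ.extend I).symm) (interior (φ.extend I).target) := by
  rw [← contMDiffOn_iff_contDiffOn]
  refine hf.comp_contMDiffOn ((contMDiffOn_extend_symm hφ).mono (interior_subset.trans ?_))
  rw [φ.extend_target, I.image_eq]

theorem fderiv_comp_extend_symm_eq_zero [ChartedSpace H S] [IsManifold I 2 S]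
    (hφ : φ ∈ IsManifold.maximalAtlas I 2 S) (hf : ContMDiff I 𝓘(ℝ, ℝ) 2 f) (hp : p ∈ φ.source)
    (hint : φ.extend I p ∈ interior (φ.extend I).target) (hc : mfderiv I 𝓘(ℝ, ℝ) f p = 0) :
    fderiv ℝ (f ∘ (φ.extend I).symm) (φ.extend I p) = 0 := by
  have hleft : (φ.extend I).symm (φ.extend I p) = p := φ.extend_left_inv hp
  have h1 : MDifferentiableAt I 𝓘(ℝ, ℝ) f ((φ.extend I).symm (φ.extend I p)) :=
    hf.mdifferentiable two_ne_zero _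
  have h2 : MDifferentiableAt 𝓘(ℝ, EuclideanSpace ℝ (Fin D)) I (φ.extend I).symm
      (φ.extend I p) := by
    refine ((contMDiffOn_extend_symm hφ).contMDiffAt ?_).mdifferentiableAt two_ne_zero
    rw [I.image_eq, ← φ.extend_target]
    exact mem_interior_iff_mem_nhds.1 hint
  rw [← mfderiv_eq_fderiv, mfderiv_comp _ h1 h2]
  have h3 : mfderiv I 𝓘(ℝ, ℝ) f ((φ.extend I).symm (φ.extend I p)) = 0 := by
    rw [hleft]; exact hc
  rw [h3]
  exact ContinuousLinearMap.zero_comp _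

theorem iteratedFDerivWithin_range_eq {g : EuclideanSpace ℝ (Fin D) → ℝ}
    {x : EuclideanSpace ℝ (Fin D)} (hx : x ∈ interior (φ.extend I).target) (j : ℕ) :
    iteratedFDerivWithin ℝ j g (range I) x = iteratedFDeriv ℝ j g x := by
  have hmem : range I ∈ 𝓝 x :=
    mem_of_superset (mem_interior_iff_mem_nhds.1 hx) (φ.extend_target_subset_range)
  rw [← iteratedFDerivWithin_univ]
  exact iteratedFDerivWithin_congr_set (eventuallyEq_univ.2 hmem) j

theorem hessianInChart_apply (hint : φ.extend I p ∈ interior (φ.extend I).target) (i j : Fin D) :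
    hessianInChart I φ f p i j = hess (f ∘ (φ.extend I).symm) (φ.extend I p)
      (EuclideanSpace.single i 1) (EuclideanSpace.single j 1) := by
  rw [hessianInChart, Matrix.of_apply, iteratedFDerivWithin_range_eq hint,
    iteratedFDeriv_two_apply]
  rfl

theorem dotProduct_hessianInChart_mulVec (hint : φ.extend I p ∈ interior (φ.extend I).target)
    (u v : EuclideanSpace ℝ (Fin D)) :
    u.ofLp ⬝ᵥ (hessianInChart I φ f p *ᵥ v.ofLp) =
      hess (f ∘ (φ.extend I).symm) (φ.extend I p) u v := by
  have hsum : ∀ w : EuclideanSpace ℝ (Fin D), w = ∑ i, w i • EuclideanSpace.single i (1 : ℝ) := by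
    intro w
    ext k
    simp [Finset.sum_apply, Pi.single_apply]
  conv_rhs => rw [hsum u, hsum v]
  simp only [map_sum, map_smul, _root_.sum_apply, _root_.smul_apply, smul_eq_mul,
    dotProduct, Matrix.mulVec, hessianInChart_apply hint, Finset.mul_sum]
  rw [Finset.sum_comm]
  refine Finset.sum_congr rfl fun i _ => Finset.sum_congr rfl fun j _ => ?_
  ring

/-- A vector killed by the form lies in the kernel of the transposed Hessian matrix, so the form is
injective; equality of the dimensions of the space and its dual does the rest. -/
theorem isInvertible_hess (hint : φ.extend I p ∈ interior (φ.extend I).target)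
    (hdet : (hessianInChart I φ f p).det ≠ 0) :
    (hess (f ∘ (φ.extend I).symm) (φ.extend I p)).IsInvertible := by
  set B := hess (f ∘ (φ.extend I).symm) (φ.extend I p) with hB
  have hinj : Function.Injective B.toLinearMap := by
    rw [injective_iff_map_eq_zero]
    intro u hu
    have hu' : B u = 0 := hu
    rw [← Matrix.det_transpose] at hdet
    have h0 : (hessianInChart I φ f p)ᵀ *ᵥ u.ofLp = 0 := by
      ext k
      have := dotProduct_hessianInChart_mulVec (f := f) hint u (EuclideanSpace.single k 1)
      rw [← hB, hu', Matrix.dotProduct_mulVec, ← Matrix.mulVec_transpose] at this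
      simpa using this
    have := Matrix.eq_zero_of_mulVec_eq_zero hdet h0
    ext k
    exact congrFun this k
  have hfin : Module.finrank ℝ (EuclideanSpace ℝ (Fin D)) =
      Module.finrank ℝ (EuclideanSpace ℝ (Fin D) →L[ℝ] ℝ) := by
    rw [← (LinearMap.toContinuousLinearMap (𝕜 := ℝ) (E := EuclideanSpace ℝ (Fin D))
      (F' := ℝ)).finrank_eq]
    exact (Subspace.dual_finrank_eq (K := ℝ) (V := EuclideanSpace ℝ (Fin D))).symm
  exact ⟨(LinearMap.linearEquivOfInjective _ hinj hfin).toContinuousLinearEquiv, by ext; rfl⟩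

/-- In a chart, the inverse of the straightening map is a Morse coordinate change. -/
theorem isMorseCoordinateChange_morseChange {R ε : ℝ} (hp : p ∈ φ.source)
    (hint : φ.extend I p ∈ interior (φ.extend I).target)
    (hR : ball (φ.extend I p) R ⊆ (φ.extend I).target)
    (h : IsNearlyQuadraticOn (f ∘ (φ.extend I).symm)
      (hess (f ∘ (φ.extend I).symm) (φ.extend I p))
      (rieszInverse (hess (f ∘ (φ.extend I).symm) (φ.extend I p))) (φ.extend I p) R ε) :
    IsMorseCoordinateChange I φ f p (R / 4)
      (morseChange (f ∘ (φ.extend I).symm) (φ.extend I p) R) := by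
  have hpos := h.pos
  refine ⟨(closedBall_subset_ball (by linarith)).trans hR, h.isBiLipschitzDiffeoOn_straightenInv,
    fun x hx => hR (h.straightenInv_mem hx), h.straightenInv_center, fun x hx => ?_⟩
  have := h.apply_straightenInv hx
  rw [dotProduct_hessianInChart_mulVec hint]
  simp only [Function.comp_apply, φ.extend_left_inv hp] at this
  exact this

end

/-! ### `C²` convergence in a chart and the main theorem. -/

section

open Metric

theorem tendstoUniformlyOn_iteratedFDeriv_of_tendstoC2 {D : ℕ} {H : Type*} [TopologicalSpace H]
    {I : ModelWithCorners ℝ (EuclideanSpace ℝ (Fin D)) H}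
    {S : Type*} [TopologicalSpace S] [ChartedSpace H S] {F : ℕ → S → ℝ} {f : S → ℝ}
    {φ : OpenPartialHomeomorph S H} (hFf : TendstoC2 I F f)
    (hφ : φ ∈ IsManifold.maximalAtlas I 2 S) {K : Set (EuclideanSpace ℝ (Fin D))}
    (hK : IsCompact K) (hKφ : K ⊆ interior (φ.extend I).target) {j : ℕ} (hj : j ≤ 2) :
    TendstoUniformlyOn (fun n => iteratedFDeriv ℝ j (F n ∘ (φ.extend I).symm))
      (iteratedFDeriv ℝ j (f ∘ (φ.extend I).symm)) atTop K := by
  have hKt := hKφ.trans interior_subset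
  have h := hFf.2.2 φ hφ ((φ.extend I).symm '' K)
    (hK.image_of_continuousOn (φ.continuousOn_extend_symm.mono hKt))
    (by rintro _ ⟨x, hx, rfl⟩
        rw [← φ.extend_source (I := I)]
        exact (φ.extend I).map_target (hKt hx)) j hj
  rw [(φ.extend I).image_symm_image_of_subset_target hKt] at h
  exact (h.congr (Eventually.of_forall fun n x hx => iteratedFDerivWithin_range_eq (hKφ hx) j)).congr_right
    fun x hx => iteratedFDerivWithin_range_eq (hKφ hx) j

end

theorem mainTheorem4 {D : ℕ} {H : Type*} [TopologicalSpace H]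
    (I : ModelWithCorners ℝ (EuclideanSpace ℝ (Fin D)) H)
    {S : Type*} [TopologicalSpace S] [T2Space S] [CompactSpace S] [ChartedSpace H S]
    [IsManifold I 2 S]
    (F : ℕ → S → ℝ) (f : S → ℝ) (P : ℕ → S) (p : S)
    (hF : ∀ n, ContMDiff I 𝓘(ℝ, ℝ) 2 (F n))
    (hf : IsMorse I f)
    (hP : ∀ n, IsMorsePoint I (F n) (P n))
    (hp : IsMorsePoint I f p)
    (hp_int : I.IsInteriorPoint p)
    (hPp : Tendsto P atTop (𝓝 p))
    (hFf : TendstoC2 I F f)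
    (φ : OpenPartialHomeomorph S H) (hφ : φ ∈ IsManifold.maximalAtlas I 2 S)
    (hpφ : p ∈ φ.source) :
    (∀ᶠ n in atTop, P n ∈ φ.source ∧ I.IsInteriorPoint (P n)) ∧
    ∃ (ρ : ℕ → ℝ) (r r' : ℝ)
      (G : ℕ → EuclideanSpace ℝ (Fin D) → EuclideanSpace ℝ (Fin D))
      (Γ : EuclideanSpace ℝ (Fin D) → EuclideanSpace ℝ (Fin D)),
      (∀ n, 0 < ρ n) ∧ 0 < r ∧ 0 < r' ∧ Tendsto ρ atTop (𝓝 r) ∧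
      (∀ n, P n ∈ φ.source → I.IsInteriorPoint (P n) →
        IsMorseCoordinateChange I φ (F n) (P n) (ρ n) (G n)) ∧
      IsMorseCoordinateChange I φ f p r Γ ∧
      Metric.closedBall (φ.extend I p) r' ⊆ Metric.closedBall (φ.extend I p) r ∧
      (∀ᶠ n in atTop,
        Metric.closedBall (φ.extend I p) r' ⊆ Metric.closedBall (φ.extend I (P n)) (ρ n)) ∧
      TendstoUniformlyOn G Γ atTop (Metric.closedBall (φ.extend I p) r') := by
  have hint : ∀ q ∈ φ.source, I.IsInteriorPoint q → φ.extend I q ∈ interior (φ.extend I).target :=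
    fun q hq => (isInteriorPoint_iff_of_mem_maximalAtlas two_ne_zero hφ hq).1
  have hΩ : IsOpen (interior (φ.extend I).target) := isOpen_interior
  set Ω := interior (φ.extend I).target with hΩdef
  have hΩt : Ω ⊆ (φ.extend I).target := interior_subset
  have hev : ∀ᶠ n in atTop, P n ∈ φ.source ∧ I.IsInteriorPoint (P n) :=
    (hPp.eventually (φ.open_source.mem_nhds hpφ)).and
      (hPp.eventually ((I.isOpen_interior (n := 2) two_ne_zero).mem_nhds hp_int))
  refine ⟨hev, ?_⟩
  set x₀ := φ.extend I p with hx₀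
  set x' : ℕ → EuclideanSpace ℝ (Fin D) := fun n => φ.extend I (P n) with hx'
  set g : EuclideanSpace ℝ (Fin D) → ℝ := f ∘ (φ.extend I).symm with hg
  set F' : ℕ → EuclideanSpace ℝ (Fin D) → ℝ := fun n => F n ∘ (φ.extend I).symm with hF'
  have hgC : ContDiffOn ℝ 2 g Ω := contDiffOn_comp_extend_symm hφ hf.1
  have hFC : ∀ n, ContDiffOn ℝ 2 (F' n) Ω := fun n => contDiffOn_comp_extend_symm hφ (hF n)
  have hx₀Ω : x₀ ∈ Ω := hint p hpφ hp_int
  have hxlim : Tendsto x' atTop (𝓝 x₀) := (φ.continuousAt_extend hpφ).tendsto.comp hPp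
  have hFc : ∀ n, P n ∈ φ.source → I.IsInteriorPoint (P n) → fderiv ℝ (F' n) (x' n) = 0 :=
    fun n h1 h2 => fderiv_comp_extend_symm_eq_zero hφ (hF n) h1 (hint _ h1 h2) (hP n).1
  have hFB : ∀ n, P n ∈ φ.source → I.IsInteriorPoint (P n) →
      (hess (F' n) (x' n)).IsInvertible :=
    fun n h1 h2 => isInvertible_hess (hint _ h1 h2) ((hP n).2 φ hφ h1)
  -- A closed ball is needed because uniform convergence is only given on compact sets.
  obtain ⟨R₀, hR₀, hball⟩ := Metric.nhds_basis_closedBall.mem_iff.1 (hΩ.mem_nhds hx₀Ω)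
  have hball' := Metric.ball_subset_closedBall.trans hball
  have hunif : ∀ j ≤ 2, TendstoUniformlyOn (fun n => iteratedFDeriv ℝ j (F' n))
      (iteratedFDeriv ℝ j g) atTop (Metric.ball x₀ R₀) := fun j hj =>
    (tendstoUniformlyOn_iteratedFDeriv_of_tendstoC2 hFf hφ (isCompact_closedBall x₀ R₀) hball
      hj).mono Metric.ball_subset_closedBall
  have hunif₀ : TendstoUniformlyOn F' g atTop (Metric.ball x₀ R₀) := by
    have := hunif 0 (by norm_num)
    rw [Metric.tendstoUniformlyOn_iff] at this ⊢
    simpa only [iteratedFDeriv_zero_eq_comp, Function.comp_apply, LinearIsometryEquiv.dist_map]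
      using this
  obtain ⟨R, ε, hRR₀, hq, hqn, hBlim⟩ := exists_isNearlyQuadraticOn_seq hR₀ (hgC.mono hball')
    (fderiv_comp_extend_symm_eq_zero hφ hf.1 hpφ hx₀Ω hp.1)
    (isInvertible_hess hx₀Ω (hp.2 φ hφ hpφ)) (fun n => (hFC n).mono hball')
    (hev.mono fun n hn => hFc n hn.1 hn.2) (hev.mono fun n hn => hFB n hn.1 hn.2) hxlim
    (tendstoUniformlyOn_hess (hunif 2 le_rfl))
  have hR := hq.pos
  have hRball : Metric.ball x₀ R ⊆ Metric.ball x₀ R₀ := Metric.ball_subset_ball (by linarith)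
  have hF₀ : Tendsto (fun n => F' n (x' n)) atTop (𝓝 (g x₀)) :=
    hunif₀.tendsto_comp (hgC.continuousOn.continuousAt (hΩ.mem_nhds hx₀Ω)).continuousWithinAt
      (tendsto_nhdsWithin_iff.2 ⟨hxlim, hxlim.eventually (Metric.ball_mem_nhds x₀ hR₀)⟩)
  have hgood : ∀ᶠ n in atTop,
      IsMorseCoordinateChange I φ (F n) (P n) (R / 4) (morseChange (F' n) (x' n) R) := by
    filter_upwards [hev, hqn, hxlim.eventually (Metric.ball_mem_nhds x₀ hR)] with n h1 h2 h3
    refine isMorseCoordinateChange_morseChange h1.1 (hint _ h1.1 h1.2) ?_ h2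
    refine (Metric.ball_subset_ball' ?_).trans (hball'.trans hΩt)
    linarith [Metric.mem_ball.1 h3]
  -- The common radius works only for large `n`; each remaining Morse point in the chart's interior
  -- part gets its own radius. Other indices receive the irrelevant values `1` and `id`.
  have hsingle : ∀ n, ∃ r G, 0 < r ∧ (P n ∈ φ.source → I.IsInteriorPoint (P n) →
      IsMorseCoordinateChange I φ (F n) (P n) r G) := by
    intro n
    by_cases hn : P n ∈ φ.source ∧ I.IsInteriorPoint (P n)
    · have hxΩ := hint _ hn.1 hn.2
      obtain ⟨R₁, hR₁, hb⟩ := Metric.isOpen_iff.1 hΩ _ hxΩ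
      obtain ⟨R', ε', hR', h⟩ := exists_isNearlyQuadraticOn hR₁ ((hFC n).mono hb)
        (hFc n hn.1 hn.2) (hFB n hn.1 hn.2)
      exact ⟨R' / 4, _, by linarith [h.pos], fun _ _ => isMorseCoordinateChange_morseChange hn.1 hxΩ
        ((Metric.ball_subset_ball hR').trans (hb.trans hΩt)) h⟩
    · exact ⟨1, id, one_pos, fun h1 h2 => (hn ⟨h1, h2⟩).elim⟩
  choose ρ₁ G₁ hρ₁ hG₁ using hsingle
  classical
  obtain ⟨N, hN⟩ := eventually_atTop.1 hgood
  have hge : ∀ᶠ n in atTop, N ≤ n := eventually_ge_atTop N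
  -- The radii equal `R/4` from `N` on, so their convergence is trivial; `R/8` leaves room for the
  -- moving centres.
  refine ⟨fun n => if N ≤ n then R / 4 else ρ₁ n, R / 4, R / 8,
    fun n => if N ≤ n then morseChange (F' n) (x' n) R else G₁ n, morseChange g x₀ R,
    fun n => ?_, by linarith, by linarith, ?_, fun n h1 h2 => ?_, ?_,
    Metric.closedBall_subset_closedBall (by linarith), ?_, ?_⟩
  · dsimp only
    split_ifs
    exacts [by linarith, hρ₁ n]
  · exact tendsto_const_nhds.congr' (hge.mono fun n hn => (if_pos hn).symm)
  · dsimp only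
    split_ifs with hn
    exacts [hN n hn, hG₁ n h1 h2]
  · exact isMorseCoordinateChange_morseChange hpφ hx₀Ω (hRball.trans (hball'.trans hΩt)) hq
  · filter_upwards [hge, hxlim.eventually
      (Metric.ball_mem_nhds x₀ (by linarith : 0 < R / 8))] with n hn hn'
    rw [if_pos hn]
    refine Metric.closedBall_subset_closedBall' ?_
    rw [dist_comm]
    linarith [Metric.mem_ball.1 hn']
  · refine (tendstoUniformlyOn_straightenInv hq hqn hxlim hBlim
      (tendsto_rieszInverse (isInvertible_hess hx₀Ω (hp.2 φ hφ hpφ)) hBlim) hF₀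
      fun z hz => hunif₀.tendsto_at (hRball hz)).congr ?_
    filter_upwards [hge] with n hn x _
    exact (congrFun (if_pos hn) x).symm
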